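/- Let $M$ be a $W^*$-algebra and let $E$ be a $W^*$-correspondence over $M$, i.e. a self-dual right Hilbert $C^*$-module over $M$ with a unital normal $*$-homomorphism $\varphi : M \to \mathcal{L}(E)$ into its adjointable operators. Let $\sigma : M \to B(H)$ be a normal unital $*$-representation on a Hilbert space $H$. Let $E\otimes_\sigma H$ be the Hilbert space tensor product with $\langle \xi\otimes h, \zeta\otimes k\rangle = \langle h, \sigma(\langle \xi,\zeta\rangle)k\rangle$, on which $M$ acts by $\varphi(\cdot)\otimes I_H$; let $E^{\otimes n}\otimes_\sigma H$ be its $n$-fold iterate (for $n=0$ it is $H$, identified with $M\otimes_\sigma H$), and let $\mathcal{F}(E)\otimes_\sigma H=\bigoplus_{n\ge 0}E^{\otimes n}\otimes_\sigma H$. Write $I_k$ for the identity of $E^{\otimes k}$. Let $\mathbb{D}(E^\sigma)$ be the set of bounded operators $\eta : H \to E\otimes_\sigma H$ with $\|\eta\|<1$ and $\eta\,\sigma(a) = (\varphi(a)\otimes I_H)\,\eta$ for all $a\in M$. For $\eta\in\mathbb{D}(E^\sigma)$ put $$\eta^{(0)}=I_H,\qquad \eta^{(n+1)}=(I_{n}\otimes\eta)\,\eta^{(n)}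 : H\to E^{\otimes (n+1)}\otimes_\sigma H,$$ $$\Delta_*=(I_H-\eta^*\eta)^{1/2},\qquad \Delta=(I_{E\otimes H}-\eta\eta^*)^{1/2},$$ and let $\mathcal{D}_*=H$ and $\mathcal{D}=E\otimes_\sigma H$ be the ranges of $\Delta_*$ and $\Delta$ (both operators are invertible because $\|\eta\|<1$). The Poisson kernel $K(\eta): H\to\mathcal{F}(E)\otimes_\sigma H$ is $$K(\eta)h=\big((I_n\otimes\Delta_*)\,\eta^{(n)}h\big)_{n\ge 0}.$$ The characteristic operator $\Theta_\eta:\mathcal{F}(E)\otimes_{\varphi\otimes I}\mathcal{D}\to\mathcal{F}(E)\otimes_\sigma\mathcal{D}_*$ is the bounded operator determined by $\Theta_\eta(\xi\otimes d)=\xi\otimes\theta_\eta d$ for $\xi\in\mathcal{F}(E)$ and $d\in\mathcal{D}$, where $$\theta_\eta d=-\eta^*d+\sum_{k=1}^{\infty}(I_k\otimes\Delta_*)(I_1\otimes\eta^{(k-1)})\Delta d\in\mathcal{F}(E)\otimes_\sigma\mathcal{D}_*,$$ the $k$-th summand lying in $E^{\otimes k}\otimes_\sigma\mathcal{D}_*$.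 Theorem. For every $\eta\in\mathbb{D}(E^\sigma)$, $$I=K(\eta)K(\eta)^*+\Theta_\eta\Theta_\eta^*\qquad\text{on }\mathcal{F}(E)\otimes_\sigma\mathcal{D}_*.$$ -/

import Mathlib

universe u v

noncomputable section
open scoped TensorProduct InnerProductSpace InnerProduct
namespace WStarCorr

/-- A `W*`-correspondence `E` over `M`: a right Hilbert `C*`-module over `M` (complete, with
`M`-valued inner product `ip`, conjugate-linear in the first variable, inducing the norm of `E`)
that is self-dual, with a unital normal `*`-homomorphism `act` (the left action `φ`) from `M` into
the algebra of adjointable operators of `E`. The right action is written `MulOpposite.op a • x`.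
Mathlib's `CStarModule` is not used: its scalars act through `inner x (a • y) = a * inner x y`. -/
structure WStarCorrespondence (M : Type v) [CStarAlgebra M] [PartialOrder M] [StarOrderedRing M]
    (E : Type u) [NormedAddCommGroup E] [NormedSpace ℂ E] [CompleteSpace E]
    [Module Mᵐᵒᵖ E] where
  /-- The `M`-valued inner product. -/
  ip : E → E → M
  ip_add_right : ∀ x y z, ip x (y + z) = ip x y + ip x z
  ip_smul_right : ∀ (c : ℂ) (x y), ip x (c • y) = c • ip x y
  ip_right_act : ∀ x y (a : M), ip x (MulOpposite.op a • y) = ip x y * a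
  star_ip : ∀ x y, star (ip x y) = ip y x
  ip_self_nonneg : ∀ x, 0 ≤ ip x x
  norm_sq_eq : ∀ x, ‖x‖ ^ 2 = ‖ip x x‖
  /-- Self-duality: every bounded module map `E → M` is `⟨y, ·⟩` for some `y`. -/
  self_dual : ∀ f : E →L[ℂ] M, (∀ x (a : M), f (MulOpposite.op a • x) = f x * a) →
    ∃ y, ∀ x, f x = ip y x
  /-- The left action `φ`, a unital homomorphism. -/
  act : M →ₐ[ℂ] (E →L[ℂ] E)
  /-- `φ(a)` is adjointable with adjoint `φ(a*)`. -/
  ip_act : ∀ (a : M) x y, ip (act a x) y = ip x (act (star a) y)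
  act_right_act : ∀ (a b : M) x,
    act a (MulOpposite.op b • x) = MulOpposite.op b • act a x
  /-- Normality: `φ` preserves suprema of upward directed sets of self-adjoint elements; the order
  of self-adjoint operators on `E` is `S ≤ T ↔ ∀ x, 0 ≤ ⟨x, (T - S) x⟩`. (`φ` is monotone, so only
  the minimality of `φ(a)` among the upper bounds has to be required.) -/
  act_normal : ∀ (S : Set M) (a : M), S.Nonempty → DirectedOn (· ≤ ·) S →
    (∀ s ∈ S, IsSelfAdjoint s) → IsLUB S a →
    ∀ T : E →L[ℂ] E, (∀ x (b : M), T (MulOpposite.op b • x) = MulOpposite.op b • T x) →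
      (∀ s ∈ S, ∀ x, 0 ≤ ip x (T x - act s x)) → ∀ x, 0 ≤ ip x (T x - act a x)

section Gram
variable {M : Type v} [CStarAlgebra M] [PartialOrder M] [StarOrderedRing M]

/-- Used to show that Gram matrices in a `C*`-algebra are positive. -/
theorem selfAdjoint_negative_part {B : Type*} [CStarAlgebra B] (G : B) (hG : IsSelfAdjoint G) :
    ∃ N R : B, star R * R = -(star N * G * N) ∧ (R = 0 → ∃ C : B, star C * C = G) := by
  set N : B := cfc (fun x : ℝ => max (-x) 0) G with hN
  set R : B := cfc (fun x : ℝ => (√(max (-x) 0)) ^ 3) G with hR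
  have hNsa : star N = N := (cfc_predicate (R := ℝ) _ G : IsSelfAdjoint _).star_eq
  have hRsa : star R = R := (cfc_predicate (R := ℝ) _ G : IsSelfAdjoint _).star_eq
  refine ⟨N, R, ?_, fun hR0 => ?_⟩
  · rw [hNsa, hRsa]
    conv_rhs => enter [1, 1, 2]; rw [← cfc_id' ℝ G]
    rw [hN, hR, ← cfc_mul .., ← cfc_mul .., ← cfc_mul .., ← cfc_neg]
    congr 1
    ext x
    rcases le_total x 0 with h | h
    · have h' : max (-x) 0 = -x := max_eq_left (by linarith)
      rw [h']
      have := Real.sq_sqrt (show 0 ≤ -x by linarith)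
      calc √(-x) ^ 3 * √(-x) ^ 3 = (√(-x) ^ 2) ^ 3 := by ring
        _ = _ := by rw [this]; ring
    · have h' : max (-x) 0 = 0 := max_eq_right (by linarith)
      rw [h']; simp
  · have hspec : ∀ x ∈ spectrum ℝ G, 0 ≤ x := by
      have h0 : cfc (fun x : ℝ => (√(max (-x) 0)) ^ 3) G = cfc (fun _ : ℝ => (0 : ℝ)) G := by
        rw [← hR, hR0]; simp
      have := (cfc_eq_cfc_iff_eqOn (R := ℝ) (a := G)).1 h0
      intro x hx
      have hx0 := this hx
      simp only at hx0
      have h2 : √(max (-x) 0) = 0 := by simpa using hx0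
      have h3 := (Real.sqrt_eq_zero (le_max_right _ _)).1 h2
      have := le_max_left (-x) 0
      linarith
    refine ⟨cfc (fun x : ℝ => √x) G, ?_⟩
    rw [(cfc_predicate (R := ℝ) _ G : IsSelfAdjoint _).star_eq, ← cfc_mul ..]
    conv_rhs => rw [← cfc_id' ℝ G]
    exact cfc_congr fun x hx => Real.mul_self_sqrt (hspec x hx)

/-- A self-adjoint matrix over `M` with nonnegative quadratic form is of the form `B* B`. -/
theorem gram_factor {n : ℕ} (G : CStarMatrix (Fin n) (Fin n) M) (hG : IsSelfAdjoint G)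
    (hpos : ∀ c : Fin n → M, 0 ≤ ∑ i, ∑ j, star (c i) * G i j * c j) :
    ∃ B : CStarMatrix (Fin n) (Fin n) M, ∀ i j, G i j = ∑ k, star (B k i) * B k j := by
  obtain ⟨N, R, key, hC⟩ := selfAdjoint_negative_part G hG
  have hR0 : R = 0 := by
    ext i k
    have h1 : (star R * R) k k = (-(star N * G * N)) k k :=
      congrArg (fun A : CStarMatrix (Fin n) (Fin n) M => A k k) key
    have h2 : (star R * R) k k = ∑ i, star (R i k) * R i k := by
      rw [CStarMatrix.mul_apply]; rfl
    have h3 : (star N * G * N) k k = ∑ i, ∑ j, star (N i k) * G i j * N j k := by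
      rw [CStarMatrix.mul_apply, Finset.sum_comm]
      refine Finset.sum_congr rfl fun j _ => ?_
      rw [CStarMatrix.mul_apply, Finset.sum_mul]
      rfl
    have h4 : ∑ i, star (R i k) * R i k ≤ 0 := by
      rw [← h2, h1, CStarMatrix.neg_apply, h3]
      exact neg_nonpos.2 (hpos fun i => N i k)
    have h5 : ∑ i, star (R i k) * R i k = 0 :=
      le_antisymm h4 (Finset.sum_nonneg fun i _ => star_mul_self_nonneg _)
    have h6 := (Finset.sum_eq_zero_iff_of_nonneg (fun i _ => star_mul_self_nonneg (R i k))).1 h5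
      i (Finset.mem_univ _)
    exact CStarRing.star_mul_self_eq_zero_iff _ |>.1 h6
  obtain ⟨C, hCC⟩ := hC hR0
  refine ⟨C, fun i j => ?_⟩
  have h1 : (star C * C) i j = G i j :=
    congrArg (fun A : CStarMatrix (Fin n) (Fin n) M => A i j) hCC
  rw [← h1, CStarMatrix.mul_apply]; rfl

end Gram

/-- A Hilbert space together with a unital `*`-representation of `M` on it. -/
structure HilbertRep (M : Type v) [CStarAlgebra M] where
  carrier : Type u
  [normedAddCommGroup : NormedAddCommGroup carrier]
  [innerProductSpace : InnerProductSpace ℂ carrier]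
  [completeSpace : CompleteSpace carrier]
  rep : M →⋆ₐ[ℂ] (carrier →L[ℂ] carrier)

attribute [instance] HilbertRep.normedAddCommGroup HilbertRep.innerProductSpace
  HilbertRep.completeSpace

instance {M : Type v} [CStarAlgebra M] : CoeSort (HilbertRep.{u} M) (Type u) :=
  ⟨HilbertRep.carrier⟩

/-- A representation `σ : M → B(H)` is normal if it preserves suprema of upward directed sets of
self-adjoint elements. -/
def HilbertRep.IsNormal {M : Type v} [CStarAlgebra M] [PartialOrder M] (K : HilbertRep.{u} M) :
    Prop :=
  ∀ (S : Set M) (a : M), S.Nonempty → DirectedOn (· ≤ ·) S → (∀ s ∈ S, IsSelfAdjoint s) →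
    IsLUB S a → IsLUB (K.rep '' S) (K.rep a)

section Intertwiner
variable {M : Type v} [CStarAlgebra M]

/-- The bounded operators `T : K → L` with `T π_K(a) = π_L(a) T` for all `a ∈ M`, as a subspace of
`B(K, L)` (with the operator norm). -/
def Intertwiner (K L : HilbertRep.{u} M) : Submodule ℂ (K →L[ℂ] L) where
  carrier := {T | ∀ a, T ∘L K.rep a = L.rep a ∘L T}
  add_mem' := by
    intro S T hS hT a
    rw [ContinuousLinearMap.add_comp, ContinuousLinearMap.comp_add, hS a, hT a]
  zero_mem' := by intro a; simp
  smul_mem' := by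
    intro c T hT a
    rw [ContinuousLinearMap.smul_comp, ContinuousLinearMap.comp_smul, hT a]

variable {K L N : HilbertRep.{u} M}

theorem Intertwiner.apply_rep (T : Intertwiner K L) (a : M) (h : K) :
    T.1 (K.rep a h) = L.rep a (T.1 h) := DFunLike.congr_fun (T.2 a) h

/-- The identity operator. -/
def Intertwiner.one (K : HilbertRep.{u} M) : Intertwiner K K := ⟨1, fun _ => rfl⟩

/-- The product `S T`. -/
def Intertwiner.comp (S : Intertwiner L N) (T : Intertwiner K L) : Intertwiner K N :=
  ⟨S.1 ∘L T.1, fun a => by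
    rw [ContinuousLinearMap.comp_assoc, T.2 a, ← ContinuousLinearMap.comp_assoc, S.2 a,
      ContinuousLinearMap.comp_assoc]⟩

/-- The adjoint `T*`. -/
def Intertwiner.adj (T : Intertwiner K L) : Intertwiner L K :=
  ⟨T.1†, fun a => by
    have h := congrArg ContinuousLinearMap.adjoint (T.2 (star a))
    rw [ContinuousLinearMap.adjoint_comp, ContinuousLinearMap.adjoint_comp,
      ← ContinuousLinearMap.star_eq_adjoint, ← ContinuousLinearMap.star_eq_adjoint,
      ← map_star, ← map_star, star_star] at h
    exact h.symm⟩

/-- The positive square root `(I - T)^{1/2}`, which lies in the commutant when `T` does. -/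
def Intertwiner.sqrtOneSub (T : Intertwiner K K) : Intertwiner K K :=
  ⟨CFC.sqrt (1 - T.1), fun a => by
    have h : Commute (1 - T.1) (K.rep a) := by
      refine (Commute.one_left _).sub_left ?_
      exact T.2 a
    exact h.cfcₙ_nnreal _⟩

end Intertwiner

namespace WStarCorrespondence

variable {M : Type v} [CStarAlgebra M] [PartialOrder M] [StarOrderedRing M]
  {E : Type u} [NormedAddCommGroup E] [NormedSpace ℂ E] [CompleteSpace E] [Module Mᵐᵒᵖ E]
  (X : WStarCorrespondence M E)

theorem ip_add_left (x y z : E) : X.ip (x + y) z = X.ip x z + X.ip y z := by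
  rw [← X.star_ip, X.ip_add_right, star_add, X.star_ip, X.star_ip]

theorem ip_smul_left (c : ℂ) (x y : E) : X.ip (c • x) y = star c • X.ip x y := by
  rw [← X.star_ip, X.ip_smul_right, star_smul, X.star_ip]

theorem ip_left_act (x y : E) (a : M) :
    X.ip (MulOpposite.op a • x) y = star a * X.ip x y := by
  rw [← X.star_ip, X.ip_right_act, star_mul, X.star_ip]

theorem ip_sum_right {ι : Type*} (s : Finset ι) (x : E) (f : ι → E) :
    X.ip x (∑ i ∈ s, f i) = ∑ i ∈ s, X.ip x (f i) :=
  map_sum (AddMonoidHom.mk' (X.ip x) (X.ip_add_right x)) f s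

theorem ip_sum_left {ι : Type*} (s : Finset ι) (x : E) (f : ι → E) :
    X.ip (∑ i ∈ s, f i) x = ∑ i ∈ s, X.ip (f i) x :=
  map_sum (AddMonoidHom.mk' (fun y => X.ip y x) (fun y z => X.ip_add_left y z x)) f s

theorem ip_gram {n : ℕ} (x : Fin n → E) : ∃ B : Fin n → Fin n → M,
    ∀ i j, X.ip (x i) (x j) = ∑ k, star (B k i) * B k j := by
  obtain ⟨B, hB⟩ := gram_factor (CStarMatrix.ofMatrix fun i j => X.ip (x i) (x j))
    (by ext i j; exact X.star_ip _ _) (fun c => by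
      have h : ∑ i, ∑ j, star (c i) * X.ip (x i) (x j) * c j
          = X.ip (∑ i, MulOpposite.op (c i) • x i) (∑ i, MulOpposite.op (c i) • x i) := by
        rw [X.ip_sum_left]
        refine Finset.sum_congr rfl fun i _ => ?_
        rw [X.ip_sum_right]
        refine Finset.sum_congr rfl fun j _ => ?_
        rw [X.ip_right_act, X.ip_left_act]
      exact h ▸ X.ip_self_nonneg _)
  exact ⟨fun i j => B i j, hB⟩

variable (K L : HilbertRep.{u} M)

/-- The algebraic tensor product of `E` and `K` over `ℂ`, to be given the semi-inner product
`⟨x ⊗ h, y ⊗ k⟩ = ⟨h, π(⟨x, y⟩) k⟩`. -/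
def PreTensor (_ : WStarCorrespondence M E) (K : HilbertRep.{u} M) : Type u := E ⊗[ℂ] K

instance : AddCommGroup (X.PreTensor K) := inferInstanceAs (AddCommGroup (E ⊗[ℂ] K))
instance : Module ℂ (X.PreTensor K) := inferInstanceAs (Module ℂ (E ⊗[ℂ] K))

/-- The functional `⟨x ⊗ h, ·⟩`. -/
def preFormAux (x : E) (h : K) : X.PreTensor K →ₗ[ℂ] ℂ :=
  TensorProduct.lift (LinearMap.mk₂ ℂ (fun (y : E) (k : K) => ⟪h, K.rep (X.ip x y) k⟫_ℂ)
    (fun y z k => by simp [X.ip_add_right])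
    (fun c y k => by simp [X.ip_smul_right])
    (fun y k l => by simp)
    (fun c y k => by simp))

/-- The elementary tensor `x ⊗ h` in the algebraic tensor product. -/
def preTmul (x : E) (h : K) : X.PreTensor K := x ⊗ₜ[ℂ] h

variable {K L}

theorem preFormAux_tmul (x y : E) (h k : K) :
    X.preFormAux K x h (X.preTmul K y k) = ⟪h, K.rep (X.ip x y) k⟫_ℂ := rfl

theorem preTensor_ext {P : Type*} [AddCommGroup P] [Module ℂ P]
    {f g : X.PreTensor K →ₗ[ℂ] P} (h : ∀ x k, f (X.preTmul K x k) = g (X.preTmul K x k)) : f = g :=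
  TensorProduct.ext' (R := ℂ) (M := E) (N := K) h

variable (K) in
/-- The semi-inner product `⟨x ⊗ h, y ⊗ k⟩ = ⟨h, π(⟨x, y⟩) k⟩`. -/
def preForm : X.PreTensor K →ₗ⋆[ℂ] X.PreTensor K →ₗ[ℂ] ℂ :=
  TensorProduct.lift (LinearMap.mk₂'ₛₗ (starRingEnd ℂ) (starRingEnd ℂ)
    (fun (x : E) (h : K) => X.preFormAux K x h)
    (fun x y h => X.preTensor_ext fun z k => by simp [preFormAux_tmul, X.ip_add_left])
    (fun c x h => X.preTensor_ext fun z k => by simp [preFormAux_tmul, X.ip_smul_left])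
    (fun x h k => X.preTensor_ext fun z l => by simp [preFormAux_tmul])
    (fun c x h => X.preTensor_ext fun z l => by simp [preFormAux_tmul, mul_comm]))

theorem preForm_tmul (x y : E) (h k : K) :
    X.preForm K (X.preTmul K x h) (X.preTmul K y k) = ⟪h, K.rep (X.ip x y) k⟫_ℂ := rfl

theorem preTensor_exists_sum (z : X.PreTensor K) :
    ∃ (n : ℕ) (x : Fin n → E) (h : Fin n → K), z = ∑ i, X.preTmul K (x i) (h i) := by
  obtain ⟨n, x, h, hz⟩ := TensorProduct.exists_sum_tmul_eq (R := ℂ) (M := E) (N := K) z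
  exact ⟨n, x, h, hz⟩

theorem preForm_gram {n : ℕ} (x : Fin n → E) : ∃ B : Fin n → Fin n → M,
    ∀ (K : HilbertRep.{u} M) (h : Fin n → K),
      X.preForm K (∑ i, X.preTmul K (x i) (h i)) (∑ i, X.preTmul K (x i) (h i))
        = ((∑ k, ‖∑ i, K.rep (B k i) (h i)‖ ^ 2 : ℝ) : ℂ) := by
  obtain ⟨B, hB⟩ := X.ip_gram x
  refine ⟨B, fun K h => ?_⟩
  have h1 : ∀ k, ((‖∑ i, K.rep (B k i) (h i)‖ ^ 2 : ℝ) : ℂ)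
      = ∑ i, ∑ j, ⟪h i, K.rep (star (B k i) * B k j) (h j)⟫_ℂ := fun k => by
    have := inner_self_eq_norm_sq_to_K (𝕜 := ℂ) (∑ i, K.rep (B k i) (h i))
    rw [Complex.ofReal_pow]
    refine this.symm.trans ?_
    rw [sum_inner]
    refine Finset.sum_congr rfl fun i _ => ?_
    rw [inner_sum]
    refine Finset.sum_congr rfl fun j _ => ?_
    rw [map_mul, map_star, mul_apply_eq_comp, ContinuousLinearMap.star_eq_adjoint,
      ContinuousLinearMap.adjoint_inner_right]
  have h2 : X.preForm K (∑ i, X.preTmul K (x i) (h i)) (∑ i, X.preTmul K (x i) (h i))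
      = ∑ i, ∑ j, ⟪h i, K.rep (X.ip (x i) (x j)) (h j)⟫_ℂ := by
    simp only [map_sum, LinearMap.sum_apply, X.preForm_tmul]
    exact Finset.sum_comm
  rw [Complex.ofReal_sum, Finset.sum_congr rfl fun k _ => h1 k, h2]
  symm
  rw [Finset.sum_comm]
  refine Finset.sum_congr rfl fun i _ => ?_
  rw [Finset.sum_comm]
  refine Finset.sum_congr rfl fun j _ => ?_
  rw [hB, map_sum, sum_apply, inner_sum]

theorem preForm_conj_symm (w z : X.PreTensor K) :
    starRingEnd ℂ (X.preForm K z w) = X.preForm K w z := by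
  obtain ⟨n, x, h, rfl⟩ := X.preTensor_exists_sum w
  obtain ⟨m, y, k, rfl⟩ := X.preTensor_exists_sum z
  simp only [map_sum, LinearMap.sum_apply, X.preForm_tmul]
  rw [Finset.sum_comm]
  refine Finset.sum_congr rfl fun i _ => Finset.sum_congr rfl fun j _ => ?_
  rw [inner_conj_symm, ← ContinuousLinearMap.adjoint_inner_right,
    ← ContinuousLinearMap.star_eq_adjoint, ← map_star, X.star_ip]

variable (K) in
/-- The semi-inner product is positive semidefinite. -/
abbrev preCore : PreInnerProductSpace.Core ℂ (X.PreTensor K) where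
  inner w z := X.preForm K w z
  conj_inner_symm := X.preForm_conj_symm
  re_inner_nonneg w := by
    obtain ⟨n, x, h, rfl⟩ := X.preTensor_exists_sum w
    obtain ⟨B, hB⟩ := X.preForm_gram x
    rw [hB K h]
    exact (Finset.sum_nonneg fun _ _ => sq_nonneg _ :
      (0 : ℝ) ≤ ∑ k, ‖∑ i, K.rep (B k i) (h i)‖ ^ 2)
  add_left := LinearMap.map_add₂ _
  smul_left w z c := LinearMap.map_smulₛₗ₂ _ c w z

instance : SeminormedAddCommGroup (X.PreTensor K) :=
  InnerProductSpace.Core.toSeminormedAddCommGroup (c := X.preCore K)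
instance : InnerProductSpace ℂ (X.PreTensor K) := InnerProductSpace.ofCore (X.preCore K)

theorem preTensor_inner (w z : X.PreTensor K) : ⟪w, z⟫_ℂ = X.preForm K w z := rfl

/-- The algebraic map `I ⊗ T`. -/
def preMap (T : K →L[ℂ] L) : X.PreTensor K →ₗ[ℂ] X.PreTensor L :=
  TensorProduct.map LinearMap.id T.toLinearMap

theorem preMap_tmul (T : K →L[ℂ] L) (x : E) (h : K) :
    X.preMap T (X.preTmul K x h) = X.preTmul L x (T h) := rfl

theorem preMap_bound (T : Intertwiner K L) (z : X.PreTensor K) :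
    ‖X.preMap T.1 z‖ ≤ ‖T‖ * ‖z‖ := by
  obtain ⟨n, x, h, rfl⟩ := X.preTensor_exists_sum z
  obtain ⟨B, hB⟩ := X.preForm_gram x
  have hsq : ∀ (N : HilbertRep.{u} M) (k : Fin n → N), ‖∑ i, X.preTmul N (x i) (k i)‖ ^ 2
      = ∑ l, ‖∑ i, N.rep (B l i) (k i)‖ ^ 2 := fun N k => by
    rw [← Complex.ofReal_inj, ← hB N k, ← X.preTensor_inner, Complex.ofReal_pow]
    exact (inner_self_eq_norm_sq_to_K (𝕜 := ℂ) (∑ i, X.preTmul N (x i) (k i))).symm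
  refine le_of_sq_le_sq ?_ (by positivity)
  rw [mul_pow, map_sum, hsq K h]
  simp only [preMap_tmul]
  rw [hsq L fun i => T.1 (h i), Finset.mul_sum]
  refine Finset.sum_le_sum fun l _ => ?_
  have : ∑ i, L.rep (B l i) (T.1 (h i)) = T.1 (∑ i, K.rep (B l i) (h i)) := by
    rw [map_sum]
    exact Finset.sum_congr rfl fun i _ => (Intertwiner.apply_rep T _ _).symm
  rw [this, ← mul_pow]
  exact pow_le_pow_left₀ (norm_nonneg _) (T.1.le_opNorm _) 2

/-- The algebraic map `φ(a) ⊗ I`. -/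
def preAct (a : M) : X.PreTensor K →ₗ[ℂ] X.PreTensor K :=
  TensorProduct.map (X.act a).toLinearMap LinearMap.id

theorem preAct_tmul (a : M) (x : E) (h : K) :
    X.preAct a (X.preTmul K x h) = X.preTmul K (X.act a x) h := rfl

theorem preAct_one : (X.preAct 1 : X.PreTensor K →ₗ[ℂ] X.PreTensor K) = LinearMap.id :=
  X.preTensor_ext fun x k => by simp [preAct_tmul]

theorem preAct_mul (a b : M) :
    (X.preAct (a * b) : X.PreTensor K →ₗ[ℂ] X.PreTensor K) = X.preAct a ∘ₗ X.preAct b :=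
  X.preTensor_ext fun x k => by simp [preAct_tmul]

theorem preTmul_add_left (x y : E) (h : K) :
    X.preTmul K (x + y) h = X.preTmul K x h + X.preTmul K y h := TensorProduct.add_tmul _ _ _

theorem preTmul_smul_left (c : ℂ) (x : E) (h : K) :
    X.preTmul K (c • x) h = c • X.preTmul K x h := rfl

theorem preAct_add (a b : M) :
    (X.preAct (a + b) : X.PreTensor K →ₗ[ℂ] X.PreTensor K) = X.preAct a + X.preAct b :=
  X.preTensor_ext fun x k => by simp [preAct_tmul, preTmul_add_left]

theorem preAct_smul (c : ℂ) (a : M) :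
    (X.preAct (c • a) : X.PreTensor K →ₗ[ℂ] X.PreTensor K) = c • X.preAct a :=
  X.preTensor_ext fun x k => by simp [preAct_tmul, preTmul_smul_left]

theorem preAct_adj (a : M) (w z : X.PreTensor K) :
    ⟪X.preAct a w, z⟫_ℂ = ⟪w, X.preAct (star a) z⟫_ℂ := by
  obtain ⟨n, x, h, rfl⟩ := X.preTensor_exists_sum w
  obtain ⟨m, y, k, rfl⟩ := X.preTensor_exists_sum z
  simp only [X.preTensor_inner, map_sum, LinearMap.sum_apply, X.preForm_tmul, X.preAct_tmul,
    X.ip_act]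

theorem preAct_bound (a : M) (z : X.PreTensor K) : ‖X.preAct a z‖ ≤ ‖a‖ * ‖z‖ := by
  have h0 : 0 ≤ algebraMap ℝ M (‖a‖ ^ 2) - star a * a := by
    rw [sub_nonneg, sq, ← CStarRing.norm_star_mul_self]
    exact IsSelfAdjoint.le_algebraMap_norm_self (.star_mul_self a)
  obtain ⟨b, hb⟩ := CStarAlgebra.nonneg_iff_eq_star_mul_self.1 h0
  have h1 : ∀ c : M, ‖X.preAct c z‖ ^ 2 = (⟪z, X.preAct (star c * c) z⟫_ℂ).re := fun c => by
    rw [preAct_mul, LinearMap.comp_apply, ← preAct_adj]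
    exact (inner_self_eq_norm_sq (𝕜 := ℂ) _).symm
  have h2 : (algebraMap ℝ M (‖a‖ ^ 2)) = ((‖a‖ ^ 2 : ℝ) : ℂ) • (1 : M) := by
    rw [Algebra.algebraMap_eq_smul_one, Complex.coe_smul]
  have h3 : star a * a + star b * b = ((‖a‖ ^ 2 : ℝ) : ℂ) • (1 : M) := by
    rw [← hb, h2]; abel
  have h4 : ‖X.preAct a z‖ ^ 2 + ‖X.preAct b z‖ ^ 2 = ‖a‖ ^ 2 * ‖z‖ ^ 2 := by
    rw [h1, h1, ← Complex.add_re, ← inner_add_right, ← LinearMap.add_apply, ← preAct_add, h3,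
      preAct_smul, preAct_one, LinearMap.smul_apply, inner_smul_right, LinearMap.id_apply,
      Complex.re_ofReal_mul]
    congr 1
    exact inner_self_eq_norm_sq (𝕜 := ℂ) z
  refine le_of_sq_le_sq ?_ (by positivity)
  rw [mul_pow, ← h4]
  exact le_add_of_nonneg_right (sq_nonneg _)


open UniformSpace

/-- The operator `φ(a) ⊗ I` on the completion. -/
def tensorRepOp (K : HilbertRep.{u} M) (a : M) :
    Completion (X.PreTensor K) →L[ℂ] Completion (X.PreTensor K) :=
  ((X.preAct a).mkContinuous ‖a‖ (X.preAct_bound a)).completion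

theorem tensorRepOp_coe (a : M) (z : X.PreTensor K) :
    X.tensorRepOp K a (z : Completion (X.PreTensor K)) = (X.preAct a z : X.PreTensor K) :=
  ContinuousLinearMap.completion_apply_coe _ _

theorem completion_ext {P : Type*} [NormedAddCommGroup P] [NormedSpace ℂ P]
    {f g : Completion (X.PreTensor K) →L[ℂ] P}
    (h : ∀ z : X.PreTensor K, f z = g z) : f = g :=
  ContinuousLinearMap.ext fun z => Completion.induction_on (p := fun z => f z = g z) z
    (isClosed_eq f.continuous g.continuous) h

theorem tensorRepOp_one : X.tensorRepOp K 1 = 1 := X.completion_ext fun z => by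
  rw [tensorRepOp_coe, preAct_one]; rfl

theorem tensorRepOp_mul (a b : M) :
    X.tensorRepOp K (a * b) = X.tensorRepOp K a * X.tensorRepOp K b :=
  X.completion_ext fun z => by
    rw [mul_apply_eq_comp, tensorRepOp_coe, tensorRepOp_coe, tensorRepOp_coe, preAct_mul]; rfl

theorem tensorRepOp_add (a b : M) :
    X.tensorRepOp K (a + b) = X.tensorRepOp K a + X.tensorRepOp K b :=
  X.completion_ext fun z => by
    rw [add_apply, tensorRepOp_coe, tensorRepOp_coe, tensorRepOp_coe, preAct_add]
    exact Completion.coe_add _ _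

theorem tensorRepOp_smul (c : ℂ) (a : M) :
    X.tensorRepOp K (c • a) = c • X.tensorRepOp K a :=
  X.completion_ext fun z => by
    rw [smul_apply, tensorRepOp_coe, tensorRepOp_coe, preAct_smul]
    exact Completion.coe_smul c (X.preAct a z)

theorem tensorRepOp_star (a : M) :
    X.tensorRepOp K (star a) = star (X.tensorRepOp K a) := by
  refine (ContinuousLinearMap.eq_adjoint_iff _ _).2 fun w z => ?_
  refine Completion.induction_on₂ (p := fun w z =>
    ⟪X.tensorRepOp K (star a) w, z⟫_ℂ = ⟪w, X.tensorRepOp K a z⟫_ℂ) w z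
    (isClosed_eq (by fun_prop) (by fun_prop)) fun w z => ?_
  rw [tensorRepOp_coe, tensorRepOp_coe, Completion.inner_coe, Completion.inner_coe,
    preAct_adj, star_star]

/-- The induced representation `a ↦ φ(a) ⊗ I`. -/
def tensorRep (K : HilbertRep.{u} M) :
    M →⋆ₐ[ℂ] (Completion (X.PreTensor K) →L[ℂ] Completion (X.PreTensor K)) :=
  { AlgHom.ofLinearMap
      { toFun := X.tensorRepOp K
        map_add' := X.tensorRepOp_add
        map_smul' := X.tensorRepOp_smul } X.tensorRepOp_one X.tensorRepOp_mul with
    map_star' := X.tensorRepOp_star }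

/-- The Hilbert space `E ⊗_π K` (the Hausdorff completion of the algebraic tensor product for
`⟨x ⊗ h, y ⊗ k⟩ = ⟨h, π(⟨x, y⟩) k⟩`), with the representation `a ↦ φ(a) ⊗ I` of `M`. -/
def tensor (K : HilbertRep.{u} M) : HilbertRep.{u} M where
  carrier := Completion (X.PreTensor K)
  rep := X.tensorRep K

/-- The elementary tensor `x ⊗ h` in `E ⊗_π K`. -/
def tmul (x : E) (h : K) : X.tensor K := (X.preTmul K x h : Completion (X.PreTensor K))

theorem tmul_add_right (x : E) (h k : K) : X.tmul x (h + k) = X.tmul x h + X.tmul x k :=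
  (congrArg _ (TensorProduct.tmul_add x h k)).trans (Completion.coe_add _ _)

theorem tmul_smul_right (c : ℂ) (x : E) (h : K) : X.tmul x (c • h) = c • X.tmul x h :=
  (congrArg _ (TensorProduct.tmul_smul c x h)).trans (Completion.coe_smul c (X.preTmul K x h))

theorem tmul_zero_right (x : E) : X.tmul x (0 : K) = 0 := by
  simpa using X.tmul_smul_right 0 x (0 : K)

theorem tmul_sum_right {ι : Type*} (s : Finset ι) (x : E) (f : ι → K) :
    X.tmul x (∑ i ∈ s, f i) = ∑ i ∈ s, X.tmul x (f i) := by
  classical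
  induction s using Finset.induction_on with
  | empty => rw [Finset.sum_empty, Finset.sum_empty, X.tmul_zero_right]
  | insert i s hi ih => rw [Finset.sum_insert hi, Finset.sum_insert hi, X.tmul_add_right, ih]

theorem inner_tmul (x y : E) (h k : K) :
    ⟪X.tmul x h, X.tmul y k⟫_ℂ = ⟪h, K.rep (X.ip x y) k⟫_ℂ :=
  (Completion.inner_coe _ _).trans (X.preForm_tmul x y h k)

theorem tensor_rep_tmul (a : M) (x : E) (h : K) :
    (X.tensor K).rep a (X.tmul x h) = X.tmul (X.act a x) h :=
  X.tensorRepOp_coe a _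

theorem tensor_induction {p : X.tensor K → Prop} (hc : IsClosed {z | p z})
    (hs : ∀ (n : ℕ) (x : Fin n → E) (h : Fin n → K), p (∑ i, X.tmul (x i) (h i))) (z) : p z := by
  refine Completion.induction_on (α := X.PreTensor K) (p := p) z hc fun z => ?_
  obtain ⟨n, x, h, rfl⟩ := X.preTensor_exists_sum z
  have := hs n x h
  have h2 : ((∑ i, X.preTmul K (x i) (h i) : X.PreTensor K) : Completion (X.PreTensor K))
      = ∑ i, X.tmul (x i) (h i) :=
    map_sum (Completion.toComplₗᵢ (𝕜 := ℂ) (E := X.PreTensor K)) _ _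
  exact h2 ▸ this

theorem tensor_ext {P : Type*} [NormedAddCommGroup P] [NormedSpace ℂ P]
    {f g : X.tensor K →L[ℂ] P} (h : ∀ x k, f (X.tmul x k) = g (X.tmul x k)) : f = g := by
  ext z
  refine X.tensor_induction (p := fun z => f z = g z) (isClosed_eq f.continuous g.continuous)
    (fun n x k => ?_) z
  simp only [map_sum, h]

/-- The operator `I_E ⊗ T : E ⊗ K → E ⊗ L`. -/
def ampOp (T : Intertwiner K L) : X.tensor K →L[ℂ] X.tensor L :=
  ((X.preMap T.1).mkContinuous ‖T‖ (X.preMap_bound T)).completion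

theorem ampOp_tmul (T : Intertwiner K L) (x : E) (h : K) :
    X.ampOp T (X.tmul x h) = X.tmul x (T.1 h) :=
  ContinuousLinearMap.completion_apply_coe _ _

/-- `I_E ⊗ T`, for an intertwiner `T : K → L`; it maps `x ⊗ h` to `x ⊗ T h`. -/
def amp (T : Intertwiner K L) : Intertwiner (X.tensor K) (X.tensor L) :=
  ⟨X.ampOp T, fun a => X.tensor_ext fun x k => by
    simp [ampOp_tmul, tensor_rep_tmul]⟩

theorem amp_tmul (T : Intertwiner K L) (x : E) (h : K) :
    (X.amp T).1 (X.tmul x h) = X.tmul x (T.1 h) := X.ampOp_tmul T x h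

theorem norm_amp_le (T : Intertwiner K L) : ‖X.amp T‖ ≤ ‖T‖ := by
  refine ContinuousLinearMap.opNorm_le_bound _ (norm_nonneg _) fun z => ?_
  refine Completion.induction_on (α := X.PreTensor K) z
    (isClosed_le (by fun_prop) (by fun_prop)) fun z => ?_
  have : X.ampOp T (z : Completion (X.PreTensor K)) = ((X.preMap T.1 z : X.PreTensor L) : Completion (X.PreTensor L)) :=
    ContinuousLinearMap.completion_apply_coe _ _
  change ‖X.ampOp T (z : Completion (X.PreTensor K))‖ ≤ _
  rw [this]
  refine (Completion.norm_coe _).trans_le ?_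
  refine (X.preMap_bound T z).trans_eq ?_
  exact congrArg (‖T‖ * ·) (Completion.norm_coe z).symm

theorem norm_tmul_le (x : E) (h : K) : ‖X.tmul x h‖ ≤ ‖x‖ * ‖h‖ := by
  refine le_of_sq_le_sq ?_ (by positivity)
  have h1 : ‖X.tmul x h‖ ^ 2 = (⟪X.tmul x h, X.tmul x h⟫_ℂ).re :=
    (inner_self_eq_norm_sq (𝕜 := ℂ) _).symm
  rw [h1, inner_tmul]
  have h2 : ‖K.rep (X.ip x x)‖ ≤ ‖x‖ ^ 2 := by
    rw [X.norm_sq_eq]; exact NonUnitalStarAlgHom.norm_apply_le _ _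
  calc (⟪h, K.rep (X.ip x x) h⟫_ℂ).re ≤ ‖h‖ * ‖K.rep (X.ip x x) h‖ := re_inner_le_norm (𝕜 := ℂ) _ _
    _ ≤ ‖h‖ * (‖x‖ ^ 2 * ‖h‖) := by
        gcongr
        exact (ContinuousLinearMap.le_opNorm _ _).trans (by gcongr)
    _ = (‖x‖ * ‖h‖) ^ 2 := by ring

end WStarCorrespondence

section HilbertSum
variable {V : Type*} [NormedAddCommGroup V] [NormedSpace ℂ V]
  {F G : ℕ → Type*} [∀ n, NormedAddCommGroup (F n)] [∀ n, InnerProductSpace ℂ (F n)]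
  [∀ n, NormedAddCommGroup (G n)] [∀ n, InnerProductSpace ℂ (G n)]


theorem memlp_of_partial {g : ∀ n, G n} {C : ℝ}
    (h : ∀ N, ∑ n ∈ Finset.range N, ‖g n‖ ^ 2 ≤ C) : Memℓp g 2 := by
  refine memℓp_gen' (C := C) fun s => ?_
  obtain ⟨N, hN⟩ := s.exists_nat_subset_range
  refine le_trans ?_ (h N)
  have : ∀ n, ‖g n‖ ^ (2 : ENNReal).toReal = ‖g n‖ ^ 2 := fun n => by norm_cast
  simp only [this]
  exact Finset.sum_le_sum_of_subset_of_nonneg hN fun _ _ _ => by positivity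

theorem lp_norm_sq (g : lp G 2) : HasSum (fun n => ‖g n‖ ^ 2) (‖g‖ ^ 2) := by
  have := lp.hasSum_norm (p := 2) (by norm_num) g
  norm_cast at this

theorem lp_norm_le {g : lp G 2} {C : ℝ} (hC : 0 ≤ C)
    (h : ∀ N, ∑ n ∈ Finset.range N, ‖g n‖ ^ 2 ≤ C ^ 2) : ‖g‖ ≤ C := by
  refine le_of_sq_le_sq ?_ hC
  exact le_of_tendsto' (lp_norm_sq g).tendsto_sum_nat h

/-- The bounded operator into a Hilbert sum with given bounded coordinates. -/
def lpOp (A : V →ₗ[ℂ] ∀ n, G n) (C : ℝ) (hC : 0 ≤ C)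
    (h : ∀ x N, ∑ n ∈ Finset.range N, ‖A x n‖ ^ 2 ≤ (C * ‖x‖) ^ 2) : V →L[ℂ] lp G 2 :=
  LinearMap.mkContinuous
    { toFun := fun x => ⟨A x, memlp_of_partial (h x)⟩
      map_add' := fun x y => lp.ext (map_add A x y)
      map_smul' := fun c x => lp.ext (map_smul A c x) } C
    fun x => lp_norm_le (by positivity) (h x)

theorem lpOp_apply (A : V →ₗ[ℂ] ∀ n, G n) (C : ℝ) (hC : 0 ≤ C)
    (h : ∀ x N, ∑ n ∈ Finset.range N, ‖A x n‖ ^ 2 ≤ (C * ‖x‖) ^ 2) (x : V) (n : ℕ) :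
    lpOp A C hC h x n = A x n := rfl

theorem partial_norm_sq_le (g : lp G 2) (N : ℕ) :
    ∑ n ∈ Finset.range N, ‖g n‖ ^ 2 ≤ ‖g‖ ^ 2 :=
  sum_le_hasSum _ (fun _ _ => by positivity) (lp_norm_sq g)

/-- The column operator `x ↦ (f n x)_n`. -/
def columnOp (f : ∀ n, V →L[ℂ] G n) (c : ℕ → ℝ) (hc : Summable c) (hf : ∀ n, ‖f n‖ ≤ c n) :
    V →L[ℂ] lp G 2 :=
  lpOp (LinearMap.pi fun n => (f n).toLinearMap) (∑' n, c n)
    (tsum_nonneg fun n => (norm_nonneg _).trans (hf n)) fun x N => by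
      have hc0 : ∀ n, 0 ≤ c n := fun n => (norm_nonneg _).trans (hf n)
      have h1 : ∀ n, ‖f n x‖ ≤ c n * ‖x‖ := fun n => (f n).le_of_opNorm_le (hf n) x
      calc ∑ n ∈ Finset.range N, ‖f n x‖ ^ 2 ≤ (∑ n ∈ Finset.range N, ‖f n x‖) ^ 2 :=
            Finset.sum_sq_le_sq_sum_of_nonneg fun _ _ => norm_nonneg _
        _ ≤ ((∑' n, c n) * ‖x‖) ^ 2 := by
            refine pow_le_pow_left₀ (Finset.sum_nonneg fun _ _ => norm_nonneg _) ?_ 2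
            refine (Finset.sum_le_sum fun n _ => h1 n).trans ?_
            rw [← Finset.sum_mul]
            exact mul_le_mul_of_nonneg_right (hc.sum_le_tsum _ fun n _ => hc0 n) (norm_nonneg _)

theorem columnOp_apply (f : ∀ n, V →L[ℂ] G n) (c : ℕ → ℝ) (hc : Summable c)
    (hf : ∀ n, ‖f n‖ ≤ c n) (x : V) (n : ℕ) : columnOp f c hc hf x n = f n x := rfl

/-- The diagonal operator `(x n)_n ↦ (A n (x n))_n`. -/
def diagOp (A : ∀ n, F n →L[ℂ] G n) (C : ℝ) (hC : 0 ≤ C) (hA : ∀ n, ‖A n‖ ≤ C) :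
    lp F 2 →L[ℂ] lp G 2 :=
  lpOp { toFun := fun x n => A n (x n)
         map_add' := fun x y => by ext n; simp
         map_smul' := fun c x => by ext n; simp } C hC fun x N => by
    calc ∑ n ∈ Finset.range N, ‖A n (x n)‖ ^ 2
        ≤ ∑ n ∈ Finset.range N, C ^ 2 * ‖x n‖ ^ 2 := Finset.sum_le_sum fun n _ => by
          rw [← mul_pow]
          exact pow_le_pow_left₀ (norm_nonneg _) ((A n).le_of_opNorm_le (hA n) _) 2
      _ ≤ (C * ‖x‖) ^ 2 := by
          rw [← Finset.mul_sum, mul_pow]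
          exact mul_le_mul_of_nonneg_left (partial_norm_sq_le x N) (by positivity)

theorem diagOp_apply (A : ∀ n, F n →L[ℂ] G n) (C : ℝ) (hC : 0 ≤ C) (hA : ∀ n, ‖A n‖ ≤ C)
    (x : lp F 2) (n : ℕ) : diagOp A C hC hA x n = A n (x n) := rfl

theorem young_partial (c a : ℕ → ℝ) (hc : Summable c) (hc0 : ∀ n, 0 ≤ c n) (N : ℕ) :
    ∑ i ∈ Finset.range N, (∑ j ∈ Finset.range (i + 1), c (i - j) * a j) ^ 2
      ≤ (∑' n, c n) ^ 2 * ∑ j ∈ Finset.range N, a j ^ 2 := by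
  have hC : 0 ≤ ∑' n, c n := tsum_nonneg hc0
  have h1 : ∀ i, (∑ j ∈ Finset.range (i + 1), c (i - j) * a j) ^ 2
      ≤ (∑' n, c n) * ∑ j ∈ Finset.range (i + 1), c (i - j) * a j ^ 2 := fun i => by
    refine (Finset.sum_sq_le_sum_mul_sum_of_sq_le_mul _ (f := fun j => c (i - j))
      (g := fun j => c (i - j) * a j ^ 2) (fun j _ => hc0 _)
      (fun j _ => mul_nonneg (hc0 _) (sq_nonneg _)) (fun j _ => by ring_nf; exact le_rfl)).trans ?_
    refine mul_le_mul_of_nonneg_right ?_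
      (Finset.sum_nonneg fun j _ => mul_nonneg (hc0 _) (sq_nonneg _))
    have := Finset.sum_range_reflect c (i + 1)
    simp only [Nat.add_sub_cancel] at this
    rw [this]
    exact hc.sum_le_tsum _ fun n _ => hc0 n
  refine (Finset.sum_le_sum fun i _ => h1 i).trans ?_
  rw [← Finset.mul_sum, sq, mul_assoc]
  refine mul_le_mul_of_nonneg_left ?_ hC
  have h2 : ∑ i ∈ Finset.range N, ∑ j ∈ Finset.range (i + 1), c (i - j) * a j ^ 2
      = ∑ j ∈ Finset.range N, ∑ i ∈ Finset.Ico j N, c (i - j) * a j ^ 2 := by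
    refine Finset.sum_comm' fun i j => ?_
    simp only [Finset.mem_range, Finset.mem_Ico]
    omega
  rw [h2, Finset.mul_sum]
  refine Finset.sum_le_sum fun j _ => ?_
  rw [← Finset.sum_mul]
  refine mul_le_mul_of_nonneg_right ?_ (sq_nonneg _)
  rw [Finset.sum_Ico_eq_sum_range]
  simp only [Nat.add_sub_cancel_left]
  exact hc.sum_le_tsum _ fun n _ => hc0 n

/-- The operator between Hilbert sums with lower triangular matrix `(A i j)_{j ≤ i}`. -/
def lowerOp (A : ∀ i j, F j →L[ℂ] G i) (c : ℕ → ℝ) (hc : Summable c) (hc0 : ∀ n, 0 ≤ c n)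
    (hA : ∀ i j, j ≤ i → ‖A i j‖ ≤ c (i - j)) : lp F 2 →L[ℂ] lp G 2 :=
  lpOp { toFun := fun x i => ∑ j ∈ Finset.range (i + 1), A i j (x j)
         map_add' := fun x y => by ext n; simp [Finset.sum_add_distrib]
         map_smul' := fun c x => by ext n; simp [Finset.smul_sum] }
    (∑' n, c n) (tsum_nonneg hc0) fun x N => by
    calc ∑ i ∈ Finset.range N, ‖∑ j ∈ Finset.range (i + 1), A i j (x j)‖ ^ 2
        ≤ ∑ i ∈ Finset.range N, (∑ j ∈ Finset.range (i + 1), c (i - j) * ‖x j‖) ^ 2 := by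
          refine Finset.sum_le_sum fun i _ => pow_le_pow_left₀ (norm_nonneg _) ?_ 2
          refine (norm_sum_le _ _).trans (Finset.sum_le_sum fun j hj => ?_)
          exact (A i j).le_of_opNorm_le (hA i j (Nat.lt_succ_iff.1 (Finset.mem_range.1 hj))) _
      _ ≤ (∑' n, c n) ^ 2 * ∑ j ∈ Finset.range N, ‖x j‖ ^ 2 := young_partial _ _ hc hc0 N
      _ ≤ ((∑' n, c n) * ‖x‖) ^ 2 := by
          rw [mul_pow]
          exact mul_le_mul_of_nonneg_left (partial_norm_sq_le x N) (by positivity)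

theorem lowerOp_apply (A : ∀ i j, F j →L[ℂ] G i) (c : ℕ → ℝ) (hc : Summable c)
    (hc0 : ∀ n, 0 ≤ c n) (hA : ∀ i j, j ≤ i → ‖A i j‖ ≤ c (i - j)) (x : lp F 2) (i : ℕ) :
    lowerOp A c hc hc0 hA x i = ∑ j ∈ Finset.range (i + 1), A i j (x j) := rfl

end HilbertSum

theorem Intertwiner.norm_comp_le {M : Type v} [CStarAlgebra M] {K L N : HilbertRep.{u} M}
    (S : Intertwiner L N) (T : Intertwiner K L) : ‖Intertwiner.comp S T‖ ≤ ‖S‖ * ‖T‖ :=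
  ContinuousLinearMap.opNorm_comp_le S.1 T.1

theorem Intertwiner.norm_adj {M : Type v} [CStarAlgebra M] {K L : HilbertRep.{u} M}
    (T : Intertwiner K L) : ‖Intertwiner.adj T‖ = ‖T‖ :=
  LinearIsometryEquiv.norm_map ContinuousLinearMap.adjoint T.1

namespace WStarCorrespondence

variable {M : Type v} [CStarAlgebra M] [PartialOrder M] [StarOrderedRing M]
  {E : Type u} [NormedAddCommGroup E] [NormedSpace ℂ E] [CompleteSpace E] [Module Mᵐᵒᵖ E]
  (X : WStarCorrespondence M E) {K L H : HilbertRep.{u} M}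

/-- The Hilbert space `E^{⊗n} ⊗_π K`, as `E ⊗ (E ⊗ ⋯ (E ⊗ K))`, with the representation
`φ_n ⊗ I` of `M`; for `n = 0` it is `M ⊗_π K = K`, with `π`. -/
def tensorPow (K : HilbertRep.{u} M) : ℕ → HilbertRep.{u} M
  | 0 => K
  | n + 1 => X.tensor (tensorPow K n)

/-- The Hilbert space `𝓕(E) ⊗_π K = ⨁ₙ E^{⊗n} ⊗_π K`. -/
abbrev Fock (K : HilbertRep.{u} M) : Type u := lp (fun n => (X.tensorPow K n : Type u)) 2

/-- The component in `E^{⊗n} ⊗_π K`. -/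
def coord (x : X.Fock K) (n : ℕ) : X.tensorPow K n := x n

variable {X} in
theorem fock_ext {x y : X.Fock K} (h : ∀ n, X.coord x n = X.coord y n) : x = y :=
  lp.ext (funext h)

/-- `I_k ⊗ T : E^{⊗k} ⊗ K → E^{⊗k} ⊗ L`. -/
def ampPow (T : Intertwiner K L) : ∀ k, Intertwiner (X.tensorPow K k) (X.tensorPow L k)
  | 0 => T
  | k + 1 => X.amp (ampPow T k)

theorem norm_ampPow_le (T : Intertwiner K L) : ∀ k, ‖X.ampPow T k‖ ≤ ‖T‖
  | 0 => le_rfl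
  | k + 1 => (X.norm_amp_le _).trans (norm_ampPow_le T k)

/-- `I_{𝓕(E)} ⊗ T : 𝓕(E) ⊗ K → 𝓕(E) ⊗ L`. -/
def fockMap (T : Intertwiner K L) : X.Fock K →L[ℂ] X.Fock L :=
  diagOp (fun n => (X.ampPow T n).1) ‖T‖ (norm_nonneg _) (X.norm_ampPow_le T)

/-- The `σ`-dual `E^σ`: the bounded operators `η : H → E ⊗_σ H` with
`η σ(a) = (φ(a) ⊗ I) η` for all `a ∈ M`. -/
abbrev SigmaDual (H : HilbertRep.{u} M) : Submodule ℂ (H →L[ℂ] X.tensor H) :=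
  Intertwiner H (X.tensor H)


/-- `I_{E^{⊗k}} ⊗ η : E^{⊗k} ⊗ H → E^{⊗(k+1)} ⊗ H`. -/
def ampDual (η : X.SigmaDual H) : ∀ k, Intertwiner (X.tensorPow H k) (X.tensorPow H (k + 1))
  | 0 => η
  | k + 1 => X.amp (ampDual η k)

theorem norm_ampDual_le (η : X.SigmaDual H) : ∀ k, ‖X.ampDual η k‖ ≤ ‖η‖
  | 0 => le_rfl
  | k + 1 => (X.norm_amp_le _).trans (norm_ampDual_le η k)

/-- `η^{(n)} : H → E^{⊗n} ⊗ H`, with `η^{(0)} = I` and `η^{(n+1)} = (I_{E^{⊗n}} ⊗ η) η^{(n)}`. -/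
def dualPow (η : X.SigmaDual H) : ∀ n, Intertwiner H (X.tensorPow H n)
  | 0 => Intertwiner.one H
  | n + 1 => Intertwiner.comp (X.ampDual η n) (dualPow η n)

theorem norm_dualPow_le (η : X.SigmaDual H) : ∀ n, ‖X.dualPow η n‖ ≤ ‖η‖ ^ n
  | 0 => by
    rw [pow_zero]
    exact ContinuousLinearMap.norm_id_le
  | n + 1 => by
    rw [pow_succ, mul_comm]
    exact (Intertwiner.norm_comp_le _ _).trans
      (mul_le_mul (X.norm_ampDual_le η n) (norm_dualPow_le η n) (norm_nonneg _) (norm_nonneg _))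

/-- The Cauchy kernel `C(η) = [η^{(0)}, η^{(1)}, η^{(2)}, …]ᵀ`. -/
def cauchyKernel (η : X.SigmaDual H) (hη : ‖η‖ < 1) : H →L[ℂ] X.Fock H :=
  columnOp (fun n => (X.dualPow η n).1) (fun n => ‖η‖ ^ n)
    (summable_geometric_of_lt_one (norm_nonneg _) hη) (X.norm_dualPow_le η)

/-- `Δ_* = (I_H - η* η)^{1/2}`. -/
def defectStar (η : X.SigmaDual H) : Intertwiner H H :=
  Intertwiner.sqrtOneSub (Intertwiner.comp (Intertwiner.adj η) η)

/-- `Δ = (I_{E ⊗ H} - η η*)^{1/2}`. -/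
def defect (η : X.SigmaDual H) : Intertwiner (X.tensor H) (X.tensor H) :=
  Intertwiner.sqrtOneSub (Intertwiner.comp η (Intertwiner.adj η))

/-- The Poisson kernel `K(η) = (I_{𝓕(E)} ⊗ Δ_*) C(η)`. -/
def poissonKernel (η : X.SigmaDual H) (hη : ‖η‖ < 1) : H →L[ℂ] X.Fock H :=
  X.fockMap (X.defectStar η) ∘L X.cauchyKernel η hη

theorem poissonKernel_apply (η : X.SigmaDual H) (hη : ‖η‖ < 1) (h : H) (n : ℕ) :
    X.coord (X.poissonKernel η hη h) n = (X.ampPow (X.defectStar η) n).1 ((X.dualPow η n).1 h) := rfl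

/-- The components of `θ_η`: `θ_0 = -η*` and `θ_{k+1} = (I_{k+1} ⊗ Δ_*) (I_1 ⊗ η^{(k)}) Δ`, a map
`E ⊗ H → E^{⊗(k+1)} ⊗ H`. Since `‖η‖ < 1`, the ranges `𝒟` of `Δ` and `𝒟_*` of `Δ_*` are all of
`E ⊗ H` and `H` (see `defect_surjective` and `defectStar_surjective`). -/
def theta (η : X.SigmaDual H) : ∀ k, Intertwiner (X.tensor H) (X.tensorPow H k)
  | 0 => -Intertwiner.adj η
  | k + 1 => Intertwiner.comp (X.ampPow (X.defectStar η) (k + 1))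
      (Intertwiner.comp (X.amp (X.dualPow η k)) (X.defect η))

/-- A summable bound for the norms of the components of `θ_η`. -/
def thetaBound (η : X.SigmaDual H) : ℕ → ℝ
  | 0 => ‖η‖
  | k + 1 => ‖X.defectStar η‖ * (‖η‖ ^ k * ‖X.defect η‖)

theorem thetaBound_nonneg (η : X.SigmaDual H) : ∀ k, 0 ≤ X.thetaBound η k
  | 0 => norm_nonneg _
  | _ + 1 => by unfold thetaBound; positivity

theorem summable_thetaBound (η : X.SigmaDual H) (hη : ‖η‖ < 1) : Summable (X.thetaBound η) :=
  (summable_nat_add_iff 1).1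
    (((summable_geometric_of_lt_one (norm_nonneg _) hη).mul_right _).mul_left _)

theorem norm_theta_le (η : X.SigmaDual H) : ∀ k, ‖X.theta η k‖ ≤ X.thetaBound η k
  | 0 => by
    change ‖-Intertwiner.adj η‖ ≤ ‖η‖
    exact (norm_neg (Intertwiner.adj η).1).trans_le (Intertwiner.norm_adj η).le
  | k + 1 => by
    refine (Intertwiner.norm_comp_le _ _).trans ?_
    refine mul_le_mul (X.norm_ampPow_le _ _) ?_ (norm_nonneg _) (norm_nonneg _)
    refine (Intertwiner.norm_comp_le _ _).trans ?_
    exact mul_le_mul_of_nonneg_right ((X.norm_amp_le _).trans (X.norm_dualPow_le η k)) (norm_nonneg _)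

/-- The operator `θ_η : 𝒟 → 𝓕(E) ⊗ 𝒟_*`,
`θ_η d = -η* d + ∑_{k ≥ 1} (I_k ⊗ Δ_*) (I_1 ⊗ η^{(k-1)}) Δ d`. -/
def thetaOp (η : X.SigmaDual H) (hη : ‖η‖ < 1) : X.tensor H →L[ℂ] X.Fock H :=
  columnOp (fun k => (X.theta η k).1) (X.thetaBound η) (X.summable_thetaBound η hη) (X.norm_theta_le η)

/-- The matrix entries `E^{⊗j} ⊗ 𝒟 → E^{⊗i} ⊗ 𝒟_*` of the characteristic operator: `I_j ⊗ θ_{i-j}`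
for `j ≤ i`, and `0` for `i < j`. -/
def entry (η : X.SigmaDual H) : ∀ i j, Intertwiner (X.tensorPow (X.tensor H) j) (X.tensorPow H i)
  | i, 0 => X.theta η i
  | 0, _ + 1 => 0
  | i + 1, j + 1 => X.amp (entry η i j)

theorem norm_entry_le (η : X.SigmaDual H) : ∀ i j, j ≤ i → ‖X.entry η i j‖ ≤ X.thetaBound η (i - j)
  | i, 0, _ => by
    cases i <;> exact X.norm_theta_le η _
  | 0, _ + 1, h => by omega
  | i + 1, j + 1, h => by
    rw [Nat.add_sub_add_right]
    exact (X.norm_amp_le _).trans (norm_entry_le η i j (by omega))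

/-- The characteristic operator `Θ_η : 𝓕(E) ⊗ 𝒟 → 𝓕(E) ⊗ 𝒟_*`, `Θ_η (ξ ⊗ d) = ξ ⊗ θ_η d`.
By `characteristicOperator_vacuum`, `characteristicOperator_creation` and
`characteristicOperator_unique` it is the unique bounded operator that restricts to `θ_η` on `𝒟`
and satisfies `Θ_η (ξ ⊗ x) = ξ ⊗ Θ_η x` for `ξ ∈ E`. -/
def characteristicOperator (η : X.SigmaDual H) (hη : ‖η‖ < 1) :
    X.Fock (X.tensor H) →L[ℂ] X.Fock H :=
  lowerOp (fun i j => (X.entry η i j).1) (X.thetaBound η) (X.summable_thetaBound η hη)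
    (X.thetaBound_nonneg η) (X.norm_entry_le η)



theorem thetaOp_coord (η : X.SigmaDual H) (hη : ‖η‖ < 1) (d : X.tensor H) (i : ℕ) :
    X.coord (X.thetaOp η hη d) i = (X.theta η i).1 d := rfl

theorem entry_zero (η : X.SigmaDual H) (i : ℕ) : X.entry η i 0 = X.theta η i := by
  cases i <;> rfl

theorem characteristicOperator_coord (η : X.SigmaDual H) (hη : ‖η‖ < 1)
    (x : X.Fock (X.tensor H)) (i : ℕ) : X.coord (X.characteristicOperator η hη x) i
      = ∑ j ∈ Finset.range (i + 1), (X.entry η i j).1 (X.coord x j) := rfl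

/-- The creation operator `T_ξ ⊗ I`, `x ↦ ξ ⊗ x`. -/
def creation (ξ : E) : X.Fock K →L[ℂ] X.Fock K :=
  lpOp { toFun := fun x n => match n with
          | 0 => 0
          | n + 1 => X.tmul ξ (x n)
         map_add' := fun x y => by
          ext n
          cases n with
          | zero => exact (add_zero (0 : K)).symm
          | succ n => exact X.tmul_add_right ξ (x n) (y n)
         map_smul' := fun c x => by
          ext n
          cases n with
          | zero => exact (smul_zero (A := K) c).symm
          | succ n => exact X.tmul_smul_right c ξ (x n) } ‖ξ‖ (norm_nonneg _) fun x N => by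
    cases N with
    | zero => simp; positivity
    | succ N =>
      rw [Finset.sum_range_succ']
      simp only [LinearMap.coe_mk, AddHom.coe_mk, norm_zero]
      calc ∑ n ∈ Finset.range N, ‖X.tmul ξ (x n)‖ ^ 2 + 0 ^ 2
          ≤ ∑ n ∈ Finset.range N, ‖ξ‖ ^ 2 * ‖x n‖ ^ 2 := by
            rw [zero_pow two_ne_zero, add_zero]
            refine Finset.sum_le_sum fun n _ => ?_
            rw [← mul_pow]
            exact pow_le_pow_left₀ (norm_nonneg _) (X.norm_tmul_le _ _) 2
        _ ≤ (‖ξ‖ * ‖x‖) ^ 2 := by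
          rw [← Finset.mul_sum, mul_pow]
          exact mul_le_mul_of_nonneg_left (partial_norm_sq_le x N) (by positivity)

theorem creation_zero (ξ : E) (x : X.Fock K) : X.coord (X.creation ξ x) 0 = 0 := rfl

theorem creation_succ (ξ : E) (x : X.Fock K) (n : ℕ) :
    X.coord (X.creation ξ x) (n + 1) = X.tmul ξ (X.coord x n) := rfl

/-- The inclusion of `E^{⊗n} ⊗ K` as the `n`-th summand of `𝓕(E) ⊗ K`. -/
def incl (n : ℕ) : X.tensorPow K n →L[ℂ] X.Fock K :=
  lp.singleContinuousLinearMap ℂ (fun n => (X.tensorPow K n : Type u)) 2 n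

theorem incl_self (n : ℕ) (k : X.tensorPow K n) : X.coord (X.incl n k) n = k :=
  lp.single_apply_self (E := fun n => (X.tensorPow K n : Type u)) 2 n k

theorem incl_ne {n i : ℕ} (k : X.tensorPow K n) (h : i ≠ n) : X.coord (X.incl n k) i = 0 :=
  lp.single_apply_ne (E := fun n => (X.tensorPow K n : Type u)) 2 n k h

theorem hasSum_incl (x : X.Fock K) : HasSum (fun n => X.incl n (X.coord x n)) x :=
  lp.hasSum_single (p := 2) (by norm_num) x

theorem creation_incl (ξ : E) (n : ℕ) (k : X.tensorPow K n) :
    X.creation ξ (X.incl n k) = X.incl (n + 1) (X.tmul ξ k : X.tensor (X.tensorPow K n)) := by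
  refine fock_ext fun i => ?_
  cases i with
  | zero => exact (X.incl_ne _ (Nat.succ_ne_zero n).symm).symm
  | succ i =>
    rw [creation_succ]
    by_cases hin : i = n
    · subst hin
      rw [X.incl_self]
      exact (X.incl_self (i + 1) _).symm
    · rw [X.incl_ne _ hin, X.tmul_zero_right]
      exact (X.incl_ne (n := n + 1) (i := i + 1) (X.tmul ξ k : X.tensor (X.tensorPow K n))
        (by omega)).symm

theorem characteristicOperator_vacuum (η : X.SigmaDual H) (hη : ‖η‖ < 1) (d : X.tensor H) :
    X.characteristicOperator η hη (X.incl 0 d) = X.thetaOp η hη d := by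
  refine fock_ext fun i => ?_
  rw [characteristicOperator_coord, thetaOp_coord, Finset.sum_range_succ', Finset.sum_eq_zero,
    zero_add, entry_zero]
  · exact congrArg _ (X.incl_self 0 d)
  · intro j _
    exact (congrArg _ (X.incl_ne (K := X.tensor H) (n := 0) d (Nat.succ_ne_zero j))).trans (map_zero _)

theorem characteristicOperator_creation (η : X.SigmaDual H) (hη : ‖η‖ < 1) (ξ : E)
    (x : X.Fock (X.tensor H)) :
    X.characteristicOperator η hη (X.creation ξ x)
      = X.creation ξ (X.characteristicOperator η hη x) := by
  refine fock_ext fun i => ?_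
  cases i with
  | zero =>
    rw [characteristicOperator_coord, zero_add, Finset.sum_range_one, creation_zero, map_zero,
      creation_zero]
  | succ i =>
    rw [characteristicOperator_coord, creation_succ, characteristicOperator_coord,
      Finset.sum_range_succ', creation_zero, map_zero, add_zero, X.tmul_sum_right]
    exact Finset.sum_congr rfl fun j _ => X.amp_tmul (X.entry η i j) ξ (X.coord x j)

theorem characteristicOperator_unique (η : X.SigmaDual H) (hη : ‖η‖ < 1)
    (Y : X.Fock (X.tensor H) →L[ℂ] X.Fock H)
    (h0 : ∀ d : X.tensor H, Y (X.incl 0 d) = X.thetaOp η hη d)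
    (h1 : ∀ ξ x, Y (X.creation ξ x) = X.creation ξ (Y x)) :
    Y = X.characteristicOperator η hη := by
  have h : ∀ n, Y ∘L X.incl n = X.characteristicOperator η hη ∘L X.incl n := by
    intro n
    induction n with
    | zero =>
      exact ContinuousLinearMap.ext fun d =>
        (h0 d).trans (X.characteristicOperator_vacuum η hη d).symm
    | succ n ih =>
      refine X.tensor_ext (K := X.tensorPow (X.tensor H) n) fun ξ k => ?_
      change Y (X.incl (n + 1) (X.tmul ξ k : X.tensor (X.tensorPow (X.tensor H) n)))
        = X.characteristicOperator η hη
          (X.incl (n + 1) (X.tmul ξ k : X.tensor (X.tensorPow (X.tensor H) n)))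
      rw [← creation_incl, h1, characteristicOperator_creation]
      exact congrArg (X.creation ξ) (DFunLike.congr_fun ih k)
  refine ContinuousLinearMap.ext fun x => ?_
  refine ((X.hasSum_incl x).mapL Y).unique ?_
  have e2 := (X.hasSum_incl x).mapL (X.characteristicOperator η hη)
  have e3 : (fun n => Y (X.incl n (X.coord x n)))
      = fun n => X.characteristicOperator η hη (X.incl n (X.coord x n)) :=
    funext fun n => DFunLike.congr_fun (h n) (X.coord x n)
  exact e3 ▸ e2

theorem isUnit_defectStar (η : X.SigmaDual H) (hη : ‖η‖ < 1) : IsUnit (X.defectStar η).1 := by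
  have h2 : ‖η.1† ∘L η.1‖ < 1 := by
    rw [ContinuousLinearMap.norm_adjoint_comp_self]
    exact mul_lt_one_of_nonneg_of_lt_one_left (norm_nonneg _) hη hη.le
  have h1 : (η.1† ∘L η.1) ≤ 1 := by
    have := IsSelfAdjoint.le_algebraMap_norm_self (a := η.1† ∘L η.1)
      (ContinuousLinearMap.isPositive_adjoint_comp_self η.1).isSelfAdjoint
    refine this.trans ?_
    rw [← map_one (algebraMap ℝ (H →L[ℂ] H))]
    exact algebraMap_mono _ h2.le
  exact (CFC.isUnit_sqrt_iff _ (sub_nonneg.2 h1)).2 (isUnit_one_sub_of_norm_lt_one h2)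

theorem isUnit_defect (η : X.SigmaDual H) (hη : ‖η‖ < 1) : IsUnit (X.defect η).1 := by
  have h2 : ‖η.1 ∘L η.1†‖ < 1 := by
    have := ContinuousLinearMap.norm_adjoint_comp_self (η.1†)
    rw [ContinuousLinearMap.adjoint_adjoint] at this
    rw [this, LinearIsometryEquiv.norm_map]
    exact mul_lt_one_of_nonneg_of_lt_one_left (norm_nonneg _) hη hη.le
  have h1 : (η.1 ∘L η.1†) ≤ 1 := by
    have := IsSelfAdjoint.le_algebraMap_norm_self (a := η.1 ∘L η.1†)
      (ContinuousLinearMap.isPositive_self_comp_adjoint η.1).isSelfAdjoint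
    refine this.trans ?_
    rw [← map_one (algebraMap ℝ (X.tensor H →L[ℂ] X.tensor H))]
    exact algebraMap_mono _ h2.le
  exact (CFC.isUnit_sqrt_iff _ (sub_nonneg.2 h1)).2 (isUnit_one_sub_of_norm_lt_one h2)

theorem defectStar_surjective (η : X.SigmaDual H) (hη : ‖η‖ < 1) :
    Function.Surjective (X.defectStar η).1 := fun y => by
  obtain ⟨u, hu⟩ := X.isUnit_defectStar η hη
  refine ⟨(u⁻¹).1 y, ?_⟩
  rw [← hu, ← mul_apply_eq_comp, u.mul_inv]; rfl

theorem defect_surjective (η : X.SigmaDual H) (hη : ‖η‖ < 1) :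
    Function.Surjective (X.defect η).1 := fun y => by
  obtain ⟨u, hu⟩ := X.isUnit_defect η hη
  refine ⟨(u⁻¹).1 y, ?_⟩
  rw [← hu, ← mul_apply_eq_comp, u.mul_inv]; rfl

end WStarCorrespondence
end WStarCorr

end

/-!
The block operator `U = [[Δ_*, -η*], [η, Δ]] : H ⊕ (E ⊗ H) → H ⊕ (E ⊗ H)` is unitary, because
`Δ_*² = I - η*η`, `Δ² = I - ηη*` and `ηΔ_* = Δη`. Writing `Kₙ` for the `n`-th component of the
Poisson kernel and `θₙ` for that of `θ_η`, one has `K₀ = Δ_*`, `θ₀ = -η*` and `Kₙ₊₁ = (I ⊗ Kₙ) η`,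
`θₙ₊₁ = (I ⊗ Kₙ) Δ`, so the row `(Kₙ, θₙ)` is the first row of `U` for `n = 0` and a multiple of
the second row for `n ≥ 1`. Since the remaining entries of `Θ_η` satisfy
`Θ_{i+1,j+1} = I ⊗ Θ_{i,j}`, the matrix entries `G` of `K(η)K(η)* + Θ_ηΘ_η*` satisfy `G₀₀ = I`,
`G_{i+1,0} = 0 = G_{0,m+1}` and `G_{i+1,m+1} = I ⊗ G_{i,m}`, which forces `G = I`.
-/

open scoped InnerProduct

namespace WStarCorr

section SquareRoot

variable {H₁ H₂ : Type*} [NormedAddCommGroup H₁] [InnerProductSpace ℂ H₁] [CompleteSpace H₁]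
  [NormedAddCommGroup H₂] [InnerProductSpace ℂ H₂] [CompleteSpace H₂]

/-- The `*`-algebra of the pairs `(a, b)` of operators on the two spaces that are intertwined by
`T : H₁ → H₂`, in the sense that `T a = b T` and `T a* = b* T`. It makes the functional calculus
of a pair available for transporting an intertwining relation from `(a, b)` to `(√a, √b)`. -/
noncomputable def intertwinedPairs (T : H₁ →L[ℂ] H₂) :
    StarSubalgebra ℂ ((H₁ →L[ℂ] H₁) × (H₂ →L[ℂ] H₂)) where
  carrier := {p | T ∘L p.1 = p.2 ∘L T ∧ T ∘L star p.1 = star p.2 ∘L T}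
  mul_mem' := by
    rintro ⟨a, b⟩ ⟨c, d⟩ ⟨hab, hab'⟩ ⟨hcd, hcd'⟩
    constructor <;> ext <;> simp_all [DFunLike.ext_iff, star_mul]
  add_mem' := by
    rintro ⟨a, b⟩ ⟨c, d⟩ ⟨hab, hab'⟩ ⟨hcd, hcd'⟩
    constructor <;> ext <;> simp_all [DFunLike.ext_iff]
  algebraMap_mem' c := by
    constructor <;> ext <;> simp [Algebra.algebraMap_eq_smul_one, star_smul]
  star_mem' := by
    rintro ⟨a, b⟩ ⟨hab, hab'⟩
    exact ⟨hab', by simpa using hab⟩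

theorem isClosed_intertwinedPairs (T : H₁ →L[ℂ] H₂) :
    IsClosed (intertwinedPairs T : Set ((H₁ →L[ℂ] H₁) × (H₂ →L[ℂ] H₂))) :=
  (isClosed_eq (by fun_prop) (by fun_prop)).inter (isClosed_eq (by fun_prop) (by fun_prop))

theorem comp_sqrt_eq_sqrt_comp {T : H₁ →L[ℂ] H₂} {a : H₁ →L[ℂ] H₁} {b : H₂ →L[ℂ] H₂}
    (ha : 0 ≤ a) (hb : 0 ≤ b) (h : T ∘L a = b ∘L T) :
    T ∘L CFC.sqrt a = CFC.sqrt b ∘L T := by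
  have hclosed := isClosed_intertwinedPairs T
  have hab : (a, b) ∈ intertwinedPairs T :=
    ⟨h, by rwa [(IsSelfAdjoint.of_nonneg ha).star_eq, (IsSelfAdjoint.of_nonneg hb).star_eq]⟩
  have hsqrt : CFC.sqrt (a, b) ∈ intertwinedPairs T := by
    rw [CFC.sqrt_eq_real_sqrt (a, b) (Prod.mk_le_mk.2 ⟨ha, hb⟩)]
    exact cfcₙ_mem (𝕜' := ℂ) Real.sqrt hab
  rw [CFC.sqrt_map_prod] at hsqrt
  exact hsqrt.1

end SquareRoot

namespace Intertwiner

variable {M : Type v} [CStarAlgebra M] {K L N P : HilbertRep.{u} M}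

theorem comp_assoc (R : Intertwiner N P) (S : Intertwiner L N) (T : Intertwiner K L) :
    comp (comp R S) T = comp R (comp S T) := rfl

theorem one_comp (T : Intertwiner K L) : comp (one L) T = T := rfl

theorem comp_zero (S : Intertwiner L N) : comp S (0 : Intertwiner K L) = 0 :=
  Subtype.ext (ContinuousLinearMap.comp_zero _)

theorem comp_add (S : Intertwiner L N) (T T' : Intertwiner K L) :
    comp S (T + T') = comp S T + comp S T' := Subtype.ext (ContinuousLinearMap.comp_add _ _ _)

theorem add_comp (S S' : Intertwiner L N) (T : Intertwiner K L) :
    comp (S + S') T = comp S T + comp S' T := Subtype.ext (ContinuousLinearMap.add_comp _ _ _)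

theorem comp_neg (S : Intertwiner L N) (T : Intertwiner K L) :
    comp S (-T) = -comp S T := Subtype.ext (ContinuousLinearMap.comp_neg _ _)

theorem neg_comp (S : Intertwiner L N) (T : Intertwiner K L) :
    comp (-S) T = -comp S T := Subtype.ext (ContinuousLinearMap.neg_comp _ _)

theorem adj_adj (T : Intertwiner K L) : adj (adj T) = T :=
  Subtype.ext (ContinuousLinearMap.adjoint_adjoint _)

theorem adj_comp (S : Intertwiner L N) (T : Intertwiner K L) :
    adj (comp S T) = comp (adj T) (adj S) := Subtype.ext (ContinuousLinearMap.adjoint_comp _ _)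

theorem adj_zero : adj (0 : Intertwiner K L) = 0 :=
  Subtype.ext (map_zero ContinuousLinearMap.adjoint)

theorem adj_add (S T : Intertwiner K L) : adj (S + T) = adj S + adj T :=
  Subtype.ext (map_add ContinuousLinearMap.adjoint S.1 T.1)

theorem adj_neg (T : Intertwiner K L) : adj (-T) = -adj T :=
  Subtype.ext (map_neg ContinuousLinearMap.adjoint T.1)

theorem adj_sqrtOneSub (T : Intertwiner K K) : adj (sqrtOneSub T) = sqrtOneSub T :=
  Subtype.ext (IsSelfAdjoint.of_nonneg (CFC.sqrt_nonneg (1 - T.1))).star_eq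

theorem sqrtOneSub_comp_self_add {T : Intertwiner K K} (hT : T.1 ≤ 1) :
    comp (sqrtOneSub T) (sqrtOneSub T) + T = one K :=
  Subtype.ext (eq_sub_iff_add_eq.1 (CFC.sqrt_mul_sqrt_self (1 - T.1) (sub_nonneg.2 hT)))

theorem comp_sqrtOneSub {T : Intertwiner K L} {R : Intertwiner K K} {S : Intertwiner L L}
    (hR : R.1 ≤ 1) (hS : S.1 ≤ 1) (h : comp T R = comp S T) :
    comp T (sqrtOneSub R) = comp (sqrtOneSub S) T := by
  refine Subtype.ext (comp_sqrt_eq_sqrt_comp (sub_nonneg.2 hR) (sub_nonneg.2 hS) ?_)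
  have h' : T.1 ∘L R.1 = S.1 ∘L T.1 := congrArg Subtype.val h
  rw [ContinuousLinearMap.comp_sub, ContinuousLinearMap.sub_comp, h']
  rfl

theorem adj_comp_self_le_one {T : Intertwiner K L} (hT : ‖T‖ ≤ 1) : (comp (adj T) T).1 ≤ 1 := by
  have hpos : 0 ≤ T.1† ∘L T.1 :=
    (ContinuousLinearMap.nonneg_iff_isPositive _).2
      (ContinuousLinearMap.isPositive_adjoint_comp_self T.1)
  refine (CStarAlgebra.norm_le_one_iff_of_nonneg _ hpos).1 ?_
  rw [ContinuousLinearMap.norm_adjoint_comp_self]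
  exact mul_le_one₀ hT (norm_nonneg _) hT

theorem comp_adj_self_le_one {T : Intertwiner K L} (hT : ‖T‖ ≤ 1) : (comp T (adj T)).1 ≤ 1 := by
  have h := adj_comp_self_le_one (T := adj T) ((norm_adj T).trans_le hT)
  rwa [adj_adj] at h

end Intertwiner

namespace WStarCorrespondence

open Intertwiner

variable {M : Type v} [CStarAlgebra M] [PartialOrder M] [StarOrderedRing M]
  {E : Type u} [NormedAddCommGroup E] [NormedSpace ℂ E] [CompleteSpace E] [Module Mᵐᵒᵖ E]
  (X : WStarCorrespondence M E) {K L N H : HilbertRep.{u} M}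

theorem intertwiner_tensor_ext {S T : Intertwiner (X.tensor K) L}
    (h : ∀ x k, S.1 (X.tmul x k) = T.1 (X.tmul x k)) : S = T :=
  Subtype.ext (X.tensor_ext h)

theorem amp_one : X.amp (one K) = one (X.tensor K) :=
  X.intertwiner_tensor_ext fun x k => X.amp_tmul (one K) x k

theorem amp_comp (S : Intertwiner L N) (T : Intertwiner K L) :
    X.amp (comp S T) = comp (X.amp S) (X.amp T) :=
  X.intertwiner_tensor_ext fun x k => by
    change _ = (X.amp S).1 ((X.amp T).1 (X.tmul x k))
    rw [amp_tmul, amp_tmul, amp_tmul]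
    rfl

theorem amp_zero : X.amp (0 : Intertwiner K L) = 0 :=
  X.intertwiner_tensor_ext fun x k => (X.amp_tmul 0 x k).trans (X.tmul_zero_right x)

theorem amp_add (S T : Intertwiner K L) : X.amp (S + T) = X.amp S + X.amp T :=
  X.intertwiner_tensor_ext fun x k => by
    change _ = (X.amp S).1 (X.tmul x k) + (X.amp T).1 (X.tmul x k)
    rw [amp_tmul, amp_tmul, amp_tmul, ← tmul_add_right]
    rfl

theorem amp_sum {ι : Type*} (s : Finset ι) (T : ι → Intertwiner K L) :
    X.amp (∑ i ∈ s, T i) = ∑ i ∈ s, X.amp (T i) :=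
  map_sum (⟨⟨X.amp, X.amp_zero⟩, X.amp_add⟩ : Intertwiner K L →+ _) T s

theorem amp_adj (T : Intertwiner K L) : X.amp (adj T) = adj (X.amp T) :=
  X.intertwiner_tensor_ext fun x l => by
    have key : innerSL ℂ (X.tmul x ((adj T).1 l)) = innerSL ℂ (X.tmul x l) ∘L (X.amp T).1 :=
      X.tensor_ext fun y k => by
        simp only [ContinuousLinearMap.comp_apply, innerSL_apply_apply, amp_tmul, inner_tmul,
          ← apply_rep]
        exact ContinuousLinearMap.adjoint_inner_left T.1 _ _
    rw [amp_tmul]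
    exact ext_inner_right ℂ fun z => (DFunLike.congr_fun key z).trans
      (ContinuousLinearMap.adjoint_inner_left (X.amp T).1 z _).symm

section Unitary

variable {η : X.SigmaDual H}

theorem adj_defectStar : adj (X.defectStar η) = X.defectStar η := adj_sqrtOneSub _

theorem adj_defect : adj (X.defect η) = X.defect η := adj_sqrtOneSub _

theorem defectStar_comp_self_add (hη : ‖η‖ ≤ 1) :
    comp (X.defectStar η) (X.defectStar η) + comp (adj η) η = one H :=
  sqrtOneSub_comp_self_add (adj_comp_self_le_one hη)

theorem defect_comp_self_add (hη : ‖η‖ ≤ 1) :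
    comp (X.defect η) (X.defect η) + comp η (adj η) = one (X.tensor H) :=
  sqrtOneSub_comp_self_add (comp_adj_self_le_one hη)

theorem comp_defectStar (hη : ‖η‖ ≤ 1) : comp η (X.defectStar η) = comp (X.defect η) η :=
  comp_sqrtOneSub (adj_comp_self_le_one hη) (comp_adj_self_le_one hη)
    (comp_assoc η (adj η) η).symm

theorem firstRow_gram (hη : ‖η‖ ≤ 1) :
    comp (X.defectStar η) (adj (X.defectStar η)) + comp (-adj η) (adj (-adj η)) = one H := by
  rw [adj_neg, adj_adj, adj_defectStar, neg_comp, comp_neg, neg_neg,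
    X.defectStar_comp_self_add hη]

theorem secondRow_firstRow_gram (hη : ‖η‖ ≤ 1) (A : Intertwiner (X.tensor H) L) :
    comp (comp A η) (adj (X.defectStar η)) + comp (comp A (X.defect η)) (adj (-adj η)) = 0 := by
  rw [adj_defectStar, adj_neg, adj_adj, comp_assoc, X.comp_defectStar hη, comp_neg, comp_assoc,
    add_neg_cancel]

theorem firstRow_secondRow_gram (hη : ‖η‖ ≤ 1) (A : Intertwiner (X.tensor H) L) :
    comp (X.defectStar η) (adj (comp A η)) + comp (-adj η) (adj (comp A (X.defect η))) = 0 := by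
  have h := congrArg adj (X.secondRow_firstRow_gram hη A)
  rwa [adj_add, adj_comp (comp A η), adj_comp (comp A _), adj_adj, adj_adj, adj_zero] at h

theorem secondRow_gram (hη : ‖η‖ ≤ 1) (A : Intertwiner (X.tensor H) L)
    (B : Intertwiner (X.tensor H) N) :
    comp (comp A η) (adj (comp B η)) + comp (comp A (X.defect η)) (adj (comp B (X.defect η)))
      = comp A (adj B) :=
  calc comp (comp A η) (adj (comp B η)) + comp (comp A (X.defect η)) (adj (comp B (X.defect η)))
      = comp A (comp (comp (X.defect η) (X.defect η) + comp η (adj η)) (adj B)) := by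
        rw [adj_comp, adj_comp, adj_defect, add_comp, comp_add, add_comm]
        rfl
    _ = comp A (adj B) := by rw [X.defect_comp_self_add hη, one_comp]

end Unitary

section Entries

variable (η : X.SigmaDual H)

theorem dualPow_succ_eq_amp_comp (n : ℕ) :
    X.dualPow η (n + 1) = comp (X.amp (X.dualPow η n)) η := by
  induction n with
  | zero =>
    change η = comp (X.amp (one H)) η
    rw [amp_one, one_comp]
  | succ n ih =>
    have hamp : comp (X.amp (X.ampDual η n)) (comp (X.amp (X.dualPow η n)) η)
        = comp (X.amp (comp (X.ampDual η n) (X.dualPow η n))) η := by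
      rw [amp_comp, comp_assoc]
    exact (congrArg (comp (X.amp (X.ampDual η n))) ih).trans hamp

/-- The component `(I_n ⊗ Δ_*) η^{(n)} : H → E^{⊗n} ⊗ H` of the Poisson kernel. -/
noncomputable def poissonCoord (n : ℕ) : Intertwiner H (X.tensorPow H n) :=
  comp (X.ampPow (X.defectStar η) n) (X.dualPow η n)

theorem poissonCoord_succ (n : ℕ) :
    X.poissonCoord η (n + 1) = comp (X.amp (X.poissonCoord η n)) η := by
  rw [poissonCoord, dualPow_succ_eq_amp_comp, poissonCoord, amp_comp]
  rfl

theorem theta_succ (n : ℕ) :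
    X.theta η (n + 1) = comp (X.amp (X.poissonCoord η n)) (X.defect η) := by
  rw [poissonCoord, amp_comp]
  rfl

theorem entry_eq_zero_of_lt : ∀ {i j : ℕ}, i < j → X.entry η i j = 0
  | 0, _ + 1, _ => rfl
  | i + 1, j + 1, h => by
    change X.amp (X.entry η i j) = 0
    rw [entry_eq_zero_of_lt (Nat.lt_of_succ_lt_succ h), amp_zero]

/-- The `(i, m)` matrix entry `E^{⊗m} ⊗ H → E^{⊗i} ⊗ H` of `K(η) K(η)* + Θ_η Θ_η*`. The sum stops
at `j = i` because `Θ_η` is lower triangular. -/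
noncomputable def gramEntry (i m : ℕ) : Intertwiner (X.tensorPow H m) (X.tensorPow H i) :=
  comp (X.poissonCoord η i) (adj (X.poissonCoord η m))
    + ∑ j ∈ Finset.range (i + 1), comp (X.entry η i j) (adj (X.entry η m j))

variable {η}

theorem gramEntry_zero_zero (hη : ‖η‖ ≤ 1) : X.gramEntry η 0 0 = one H := by
  rw [gramEntry, Finset.sum_range_one]
  exact X.firstRow_gram hη

theorem gramEntry_zero_succ (hη : ‖η‖ ≤ 1) (m : ℕ) : X.gramEntry η 0 (m + 1) = 0 := by
  rw [gramEntry, Finset.sum_range_one, entry_zero, entry_zero, theta_succ, poissonCoord_succ]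
  exact X.firstRow_secondRow_gram hη _

theorem gramEntry_succ_zero (hη : ‖η‖ ≤ 1) (i : ℕ) : X.gramEntry η (i + 1) 0 = 0 := by
  have hzero : ∀ j ∈ Finset.range (i + 1),
      comp (X.entry η (i + 1) (j + 1)) (adj (X.entry η 0 (j + 1))) = 0 := fun j _ => by
    rw [X.entry_eq_zero_of_lt η j.succ_pos, adj_zero, comp_zero]
  rw [gramEntry, Finset.sum_range_succ', Finset.sum_eq_zero hzero, zero_add, entry_zero,
    entry_zero, theta_succ, poissonCoord_succ]
  exact X.secondRow_firstRow_gram hη _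

theorem gramEntry_succ_succ (hη : ‖η‖ ≤ 1) (i m : ℕ) :
    X.gramEntry η (i + 1) (m + 1) = X.amp (X.gramEntry η i m) := by
  have hentry : ∀ j, comp (X.entry η (i + 1) (j + 1)) (adj (X.entry η (m + 1) (j + 1)))
      = X.amp (comp (X.entry η i j) (adj (X.entry η m j))) := fun j => by
    rw [amp_comp, amp_adj]
    rfl
  have hrow : comp (X.poissonCoord η (i + 1)) (adj (X.poissonCoord η (m + 1)))
        + comp (X.theta η (i + 1)) (adj (X.theta η (m + 1)))
      = X.amp (comp (X.poissonCoord η i) (adj (X.poissonCoord η m))) := by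
    rw [theta_succ, theta_succ, poissonCoord_succ, poissonCoord_succ, amp_comp, amp_adj]
    exact X.secondRow_gram hη _ _
  rw [gramEntry, Finset.sum_range_succ', entry_zero, entry_zero, add_comm (Finset.sum _ _),
    ← add_assoc, gramEntry, amp_add, amp_sum]
  exact congrArg₂ (· + ·) hrow (Finset.sum_congr rfl fun j _ => hentry j)

theorem gramEntry_self (hη : ‖η‖ ≤ 1) : ∀ i, X.gramEntry η i i = one (X.tensorPow H i)
  | 0 => X.gramEntry_zero_zero hη
  | i + 1 => by
    rw [X.gramEntry_succ_succ hη, gramEntry_self hη i]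
    exact X.amp_one

theorem gramEntry_of_ne (hη : ‖η‖ ≤ 1) : ∀ {i m : ℕ}, i ≠ m → X.gramEntry η i m = 0
  | 0, 0, h => absurd rfl h
  | i + 1, 0, _ => X.gramEntry_succ_zero hη i
  | 0, m + 1, _ => X.gramEntry_zero_succ hη m
  | i + 1, m + 1, h => by
    rw [X.gramEntry_succ_succ hη, gramEntry_of_ne hη (ne_of_apply_ne Nat.succ h)]
    exact X.amp_zero

end Entries

section Fock

theorem adjoint_incl (n : ℕ) (x : X.Fock K) : ((X.incl n)†) x = X.coord x n :=
  ext_inner_left ℂ fun k => (ContinuousLinearMap.adjoint_inner_right _ k x).trans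
    (lp.inner_single_left (𝕜 := ℂ) (G := fun n => (X.tensorPow K n : Type u)) n k x)

theorem fock_hom_ext {P : Type*} [NormedAddCommGroup P] [NormedSpace ℂ P]
    {S T : X.Fock K →L[ℂ] P} (h : ∀ n k, S (X.incl n k) = T (X.incl n k)) : S = T :=
  lp.ext_continuousLinearMap (by norm_num) fun n => ContinuousLinearMap.ext (h n)

theorem adjoint_apply_incl {V : Type*} [NormedAddCommGroup V] [InnerProductSpace ℂ V]
    [CompleteSpace V] {S : V →L[ℂ] X.Fock K} {n : ℕ} {T : V →L[ℂ] X.tensorPow K n}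
    (h : ∀ v, X.coord (S v) n = T v) (k : X.tensorPow K n) : (S†) (X.incl n k) = (T†) k := by
  have hT : (X.incl n)† ∘L S = T :=
    ContinuousLinearMap.ext fun v => (X.adjoint_incl n (S v)).trans (h v)
  rw [← hT, ContinuousLinearMap.adjoint_comp, ContinuousLinearMap.adjoint_adjoint]
  rfl

variable {η : X.SigmaDual H} (hη : ‖η‖ < 1)

theorem adjoint_poissonKernel_incl (m : ℕ) (y : X.tensorPow H m) :
    ((X.poissonKernel η hη)†) (X.incl m y) = (adj (X.poissonCoord η m)).1 y :=
  X.adjoint_apply_incl (T := (X.poissonCoord η m).1)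
    (fun h => X.poissonKernel_apply η hη h m) y

theorem coord_characteristicOperator_incl (i j : ℕ) (z : X.tensorPow (X.tensor H) j) :
    X.coord (X.characteristicOperator η hη (X.incl j z)) i = (X.entry η i j).1 z := by
  rw [characteristicOperator_coord, Finset.sum_eq_single j, incl_self]
  · intro l _ hl
    rw [X.incl_ne z hl, map_zero]
  · intro hj
    rw [X.entry_eq_zero_of_lt η (by simpa using hj)]
    rfl

theorem coord_adjoint_characteristicOperator_incl (m j : ℕ) (y : X.tensorPow H m) :
    X.coord (((X.characteristicOperator η hη)†) (X.incl m y)) j = (adj (X.entry η m j)).1 y := by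
  rw [← adjoint_incl, ← ContinuousLinearMap.comp_apply, ← ContinuousLinearMap.adjoint_comp]
  exact X.adjoint_apply_incl (fun z => X.coord_characteristicOperator_incl hη m j z) y

theorem coord_gram_incl (i m : ℕ) (y : X.tensorPow H m) :
    X.coord ((X.poissonKernel η hη ∘L (X.poissonKernel η hη)†
      + X.characteristicOperator η hη ∘L (X.characteristicOperator η hη)†) (X.incl m y)) i
      = (X.gramEntry η i m).1 y := by
  change X.coord (X.poissonKernel η hη (((X.poissonKernel η hη)†) (X.incl m y))) i
    + X.coord (X.characteristicOperator η hη
        (((X.characteristicOperator η hη)†) (X.incl m y))) i = _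
  rw [adjoint_poissonKernel_incl, poissonKernel_apply, characteristicOperator_coord]
  simp only [coord_adjoint_characteristicOperator_incl]
  rw [gramEntry, Submodule.coe_add, Submodule.coe_sum, add_apply, sum_apply]
  rfl

end Fock

end WStarCorrespondence

end WStarCorr

theorem theorem4p2_general
    {M : Type v} [CStarAlgebra M] [PartialOrder M] [StarOrderedRing M]
    {E : Type u} [NormedAddCommGroup E] [NormedSpace ℂ E] [CompleteSpace E] [Module Mᵐᵒᵖ E]
    (X : WStarCorr.WStarCorrespondence M E) (H : WStarCorr.HilbertRep.{u} M)
    (η : X.SigmaDual H) (hη : ‖η‖ < 1) :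
    (1 : X.Fock H →L[ℂ] X.Fock H)
      = X.poissonKernel η hη ∘L ContinuousLinearMap.adjoint (X.poissonKernel η hη)
        + X.characteristicOperator η hη ∘L
          ContinuousLinearMap.adjoint (X.characteristicOperator η hη) := by
  refine X.fock_hom_ext fun m y => WStarCorr.WStarCorrespondence.fock_ext fun i => ?_
  rw [X.coord_gram_incl hη]
  change X.coord (X.incl m y) i = _
  rcases eq_or_ne i m with rfl | hne
  · rw [X.gramEntry_self hη.le, X.incl_self]
    rfl
  · rw [X.gramEntry_of_ne hη.le hne, X.incl_ne y hne]
    rfl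

theorem theorem4p2
    {M : Type v} [CStarAlgebra M] [PartialOrder M] [StarOrderedRing M] [WStarAlgebra M]
    {E : Type u} [NormedAddCommGroup E] [NormedSpace ℂ E] [CompleteSpace E] [Module Mᵐᵒᵖ E]
    (X : WStarCorr.WStarCorrespondence M E)
    (H : WStarCorr.HilbertRep.{u} M) (hH : H.IsNormal)
    (η : X.SigmaDual H) (hη : ‖η‖ < 1) :
    (1 : X.Fock H →L[ℂ] X.Fock H)
      = X.poissonKernel η hη ∘L ContinuousLinearMap.adjoint (X.poissonKernel η hη)
        + X.characteristicOperator η hη ∘L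
          ContinuousLinearMap.adjoint (X.characteristicOperator η hη) :=
  theorem4p2_general X H η hη
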